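/- Let $\lambda=2\cos(\pi/5)$, let $S=\begin{pmatrix}0&1\\-1&0\end{pmatrix}$ and $T=\begin{pmatrix}1&\lambda\\0&1\end{pmatrix}$, let $H_5=\langle S,T\rangle\subseteq SL_2(\mathbb R)$, let $Z=\{\pm I\}\subseteq H_5$, and let $G_5=H_5/Z$ be the (inhomogeneous) Hecke group. For an ideal $A$ of $\mathbb Z[\lambda]$ put $$H(5,A)=\{(a_{ij})\in H_5 : a_{11}-1,\ a_{22}-1,\ a_{12},\ a_{21}\in A\},\qquad G(5,A)=H(5,A)Z/Z .$$ A subgroup $K$ of $G_5$ is called congruence if $G(5,A)\subseteq K$ for some nonzero ideal $A$ of $\mathbb Z[\lambda]$. Let $G_5^5$ be the subgroup of $G_5$ generated by all elements $x^5$ with $x\in G_5$, and let $G_5'$ be the commutator subgroup of $G_5$. **Proposition 5.2.** Neither $G_5^5$ nor $G_5'$ is a congruence subgroup of $G_5$; that is, there is no nonzero ideal $A$ of $\mathbb Z[\lambda]$ with $G(5,A)\subseteq G_5^5$, and none with $G(5,A)\subseteq G_5'$. -/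

import Mathlib

noncomputable section

namespace Hecke

/-- The number `λ_q = 2 cos (π / q)`. -/
def lam (q : ℕ) : ℝ := 2 * Real.cos (Real.pi / q)

/-- The ring `ℤ[λ_q]`, as a subring of `ℝ`. -/
abbrev ZLam (q : ℕ) : Subalgebra ℤ ℝ := Algebra.adjoin ℤ {lam q}

/-- The matrix `S = (0, 1; -1, 0)`. -/
def S : Matrix.SpecialLinearGroup (Fin 2) ℝ :=
  ⟨!![0, 1; -1, 0], by simp [Matrix.det_fin_two_of]⟩

/-- The matrix `T = (1, λ_q; 0, 1)`. -/
def T (q : ℕ) : Matrix.SpecialLinearGroup (Fin 2) ℝ :=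
  ⟨!![1, lam q; 0, 1], by simp [Matrix.det_fin_two_of]⟩

/-- The homogeneous Hecke group `H_q`, the subgroup of `SL₂(ℝ)` generated by `S` and `T`. -/
def H (q : ℕ) : Subgroup (Matrix.SpecialLinearGroup (Fin 2) ℝ) :=
  Subgroup.closure {S, T q}

/-- The group `Z = {I, -I}`, as a subgroup of `SL₂(ℝ)`. -/
def Z : Subgroup (Matrix.SpecialLinearGroup (Fin 2) ℝ) :=
  Subgroup.zpowers (-1)

instance Z_normal : Z.Normal := by
  constructor
  rintro _ ⟨n, rfl⟩ g
  refine ⟨n, ?_⟩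
  have h : Commute g (-1 : Matrix.SpecialLinearGroup (Fin 2) ℝ) := by
    simp [Commute, SemiconjBy]
  change (-1 : Matrix.SpecialLinearGroup (Fin 2) ℝ) ^ n = g * (-1) ^ n * g⁻¹
  rw [(h.zpow_right n).eq, mul_inv_cancel_right]

/-- The group `Z` is contained in `H_q`, because `-I = S²`. -/
theorem Z_le_H (q : ℕ) : Z ≤ H q := by
  have h : S * S = -1 := by
    apply Subtype.ext
    rw [Matrix.SpecialLinearGroup.coe_mul]
    ext i j
    fin_cases i <;> fin_cases j <;> simp [S]
  rw [Z, Subgroup.zpowers_le, ← h]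
  have hS : S ∈ H q := Subgroup.subset_closure (by simp)
  exact mul_mem hS hS

/-- The inhomogeneous Hecke group `G_q = H_q / Z`. -/
abbrev G (q : ℕ) : Type := H q ⧸ Z.subgroupOf (H q)

/-- An ideal `A` of `ℤ[λ_q]`, viewed as a set of real numbers. -/
def idealSet {q : ℕ} (A : Ideal (ZLam q)) : Set ℝ := {x | ∃ a ∈ A, (a : ℝ) = x}

theorem idealSet_zero {q : ℕ} (A : Ideal (ZLam q)) : (0 : ℝ) ∈ idealSet A :=
  ⟨0, A.zero_mem, rfl⟩

theorem idealSet_add {q : ℕ} (A : Ideal (ZLam q)) {x y : ℝ}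
    (hx : x ∈ idealSet A) (hy : y ∈ idealSet A) : x + y ∈ idealSet A := by
  obtain ⟨a, ha, rfl⟩ := hx
  obtain ⟨b, hb, rfl⟩ := hy
  exact ⟨a + b, A.add_mem ha hb, rfl⟩

theorem idealSet_neg {q : ℕ} (A : Ideal (ZLam q)) {x : ℝ}
    (hx : x ∈ idealSet A) : -x ∈ idealSet A := by
  obtain ⟨a, ha, rfl⟩ := hx
  exact ⟨-a, A.neg_mem ha, rfl⟩

theorem idealSet_mul {q : ℕ} (A : Ideal (ZLam q)) {x y : ℝ}
    (hx : x ∈ idealSet A) (hy : y ∈ idealSet A) : x * y ∈ idealSet A := by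
  obtain ⟨a, ha, rfl⟩ := hx
  obtain ⟨b, hb, rfl⟩ := hy
  exact ⟨a * b, A.mul_mem_left a hb, rfl⟩

/-- The principal congruence subgroup `H(q, A)` of `H_q` of level `A`: the matrices
`(a_ij) ∈ H_q` such that `a₁₁ - 1`, `a₂₂ - 1`, `a₁₂`, `a₂₁` belong to `A`. -/
def principalH (q : ℕ) (A : Ideal (ZLam q)) : Subgroup (H q) where
  carrier := {M | M.1 0 0 - 1 ∈ idealSet A ∧ M.1 1 1 - 1 ∈ idealSet A ∧
    M.1 0 1 ∈ idealSet A ∧ M.1 1 0 ∈ idealSet A}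
  one_mem' := by
    have h := idealSet_zero A
    simp [h]
  mul_mem' := by
    rintro ⟨M, hM⟩ ⟨N, hN⟩ ⟨a, d, b, c⟩ ⟨a', d', b', c'⟩
    dsimp only at a b c d a' b' c' d'
    simp only [Set.mem_ofPred_eq, Subgroup.coe_mul, Matrix.SpecialLinearGroup.coe_mul,
      Matrix.mul_apply, Fin.sum_univ_two]
    refine ⟨?_, ?_, ?_, ?_⟩
    · convert idealSet_add A (idealSet_add A (idealSet_mul A a a') (idealSet_add A a a'))
        (idealSet_mul A b c') using 1
      ring
    · convert idealSet_add A (idealSet_add A (idealSet_mul A d d') (idealSet_add A d d'))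
        (idealSet_mul A c b') using 1
      ring
    · convert idealSet_add A (idealSet_add A (idealSet_mul A a b') b')
        (idealSet_add A (idealSet_mul A b d') b) using 1
      ring
    · convert idealSet_add A (idealSet_add A (idealSet_mul A c a') c)
        (idealSet_add A (idealSet_mul A d c') c') using 1
      ring
  inv_mem' := by
    rintro ⟨M, hM⟩ ⟨a, d, b, c⟩
    dsimp only at a b c d
    simp only [Set.mem_ofPred_eq, InvMemClass.coe_inv, Matrix.SpecialLinearGroup.coe_inv,
      Matrix.adjugate_fin_two, Matrix.of_apply, Matrix.cons_val', Matrix.cons_val_zero,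
      Matrix.cons_val_one, Matrix.cons_val_fin_one]
    exact ⟨d, a, idealSet_neg A b, idealSet_neg A c⟩

/-- The principal congruence subgroup `G(q, A) = H(q, A) Z / Z` of `G_q`, that is, the image of
`H(q, A)` under the quotient map `H_q → G_q`. -/
def principalG (q : ℕ) (A : Ideal (ZLam q)) : Subgroup (G q) :=
  (principalH q A).map (QuotientGroup.mk' (Z.subgroupOf (H q)))

/-- A subgroup of `G_q` is congruence if it contains `G(q, A)` for some nonzero ideal `A` of
`ℤ[λ_q]`. (The group `G(q, 0)` is trivial, so the zero ideal has to be excluded.) -/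
def IsCongruence {q : ℕ} (K : Subgroup (G q)) : Prop :=
  ∃ A : Ideal (ZLam q), A ≠ ⊥ ∧ principalG q A ≤ K

/-- The power subgroup `Γⁿ` of a group `Γ`: the subgroup generated by all `n`-th powers. -/
def powerSubgroup (Γ : Type*) [Group Γ] (n : ℕ) : Subgroup Γ :=
  Subgroup.closure (Set.range fun x : Γ => x ^ n)

end Hecke

end

/-!
The group `G₅` is the free product of `⟨S⟩ ≅ C₂` and `⟨TS⟩ ≅ C₅`. This is proved by ping-pong
(`freeProductHom_injective`): `S` interchanges the positive and the negative half-line, and the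
nontrivial powers of `TS` carry the negative half-line into the positive one. Hence there is a
character `φ : G₅ → ℤ/5` with `φ(S) = 0` and `φ(T) = 1` (`exists_character`), and both `G₅⁵` and
`G₅'` lie in its kernel. It remains to see that `φ` is nontrivial on every `G(5, A)` with `A ≠ 0`.

Such an `A` contains a positive integer `5ᵏ m` with `5 ∤ m`, hence a number `m√5ʲ`, where
`√5 = 2λ - 1`. That `φ` is nontrivial on `Γ(m√5ʲ)` is shown by induction on `j`
(`exists_red_eq_one_character_ne_one`). At level `m` one has `φ(T ^ m) = m ≠ 0`. The quotient of
two successive levels embeds in `SL₂(𝔽₅)` at the bottom and in the trace zero matrices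
`sl₂(𝔽₅)` higher up, and neither leaves room for a nontrivial character invariant under conjugation.
Concretely, `S` and `R = T⁻¹ S T S⁻¹ T⁻¹` anticommute modulo `√5`, so conjugation by `1, S, R, RS`
is an action of the Klein four-group on `sl₂(𝔽₅)` without nonzero fixed vectors. The product of the
four conjugates of `h` by these elements therefore lies one level deeper than `h`
(`prod_conj_eq_one`), while `φ` takes the value `4 φ(h) ≠ 0` on it. At the bottom, `R S⁻¹` conjugates
`T ^ m` into `T ^ (-m)` modulo `m√5` (`conj_tMat_mul_tMat`).
-/

namespace Hecke

open Matrix Matrix.SpecialLinearGroup Monoid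

/-! ### The number `λ₅` -/

theorem lam_five_sq : lam 5 ^ 2 = lam 5 + 1 := by
  have h := Real.quadratic_root_cos_pi_div_five
  simp only [lam, Nat.cast_ofNat]
  linear_combination h

theorem one_lt_lam_five : 1 < lam 5 := by
  have hpos : 0 < lam 5 := by
    have : 0 < Real.cos (Real.pi / (5 : ℕ)) :=
      Real.cos_pos_of_mem_Ioo ⟨by have := Real.pi_pos; push_cast; linarith,
        by have := Real.pi_pos; push_cast; linarith⟩
    simpa [lam] using this
  nlinarith [lam_five_sq]

/-! ### Homomorphisms out of `ℤ/n` -/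

/-- The homomorphism from the cyclic group of order `n` (written multiplicatively) that sends the
standard generator to an element `g` with `g ^ n = 1`. -/
noncomputable def cyclicHom {Γ : Type*} [Group Γ] (n : ℕ) (g : Γ) (hg : g ^ n = 1) :
    Multiplicative (ZMod n) →* Γ :=
  AddMonoidHom.toMultiplicativeLeft (ZMod.lift n
    ⟨zmultiplesHom (Additive Γ) (Additive.ofMul g), by
      simp [← ofMul_pow, hg]⟩)

theorem cyclicHom_ofAdd {Γ : Type*} [Group Γ] (n : ℕ) (g : Γ) (hg : g ^ n = 1) (k : ℕ) :
    cyclicHom n g hg (Multiplicative.ofAdd (k : ZMod n)) = g ^ k := by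
  have h := ZMod.lift_coe n (A := Additive Γ)
    ⟨zmultiplesHom (Additive Γ) (Additive.ofMul g), by simp [← ofMul_pow, hg]⟩ (k : ℤ)
  rw [Int.cast_natCast] at h
  simp only [cyclicHom, AddMonoidHom.coe_toMultiplicativeLeft, Function.comp_apply, toAdd_ofAdd, h]
  simp [← ofMul_pow]

/-- A nontrivial element of the cyclic group of order `n` is a power `0 < k < n` of the
generator. -/
theorem exists_cyclicHom_eq_pow {Γ : Type*} [Group Γ] (n : ℕ) [NeZero n] (g : Γ) (hg : g ^ n = 1)
    {x : Multiplicative (ZMod n)} (hx : x ≠ 1) :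
    ∃ k : ℕ, 0 < k ∧ k < n ∧ cyclicHom n g hg x = g ^ k := by
  refine ⟨(Multiplicative.toAdd x).val, Nat.pos_of_ne_zero fun h => hx ?_, ZMod.val_lt _, ?_⟩
  · exact (ZMod.val_eq_zero _).1 h
  · rw [← cyclicHom_ofAdd n g hg, ZMod.natCast_zmod_val, ofAdd_toAdd]

/-! ### The Hecke group `G₅` as a free product -/

theorem S_mem_H (q : ℕ) : S ∈ H q := Subgroup.subset_closure (by simp)

theorem T_mem_H (q : ℕ) : T q ∈ H q := Subgroup.subset_closure (by simp)

/-- The quotient map `H_q → G_q`. -/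
noncomputable def toG (q : ℕ) : H q →* G q := QuotientGroup.mk' (Z.subgroupOf (H q))

/-- The matrix `S` as an element of `H_q`. -/
noncomputable def SH (q : ℕ) : H q := ⟨S, S_mem_H q⟩

/-- The matrix `T` as an element of `H_q`. -/
noncomputable def TH (q : ℕ) : H q := ⟨T q, T_mem_H q⟩

theorem coe_SH (q : ℕ) : ((SH q : H q) : Matrix (Fin 2) (Fin 2) ℝ) = !![0, 1; -1, 0] := rfl

theorem coe_TH (q : ℕ) : ((TH q : H q) : Matrix (Fin 2) (Fin 2) ℝ) = !![1, lam q; 0, 1] := rfl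

theorem eq_or_eq_neg_of_mem_Z {g : SpecialLinearGroup (Fin 2) ℝ} (hg : g ∈ Z) :
    g = 1 ∨ g = -1 := by
  obtain ⟨n, rfl⟩ := hg
  rcases Int.even_or_odd n with h | h
  · exact .inl h.neg_one_zpow
  · exact .inr h.neg_one_zpow

theorem toG_eq_one_of_eq_neg_one {q : ℕ} {M : H q} (h : M.1 = -1) : toG q M = 1 := by
  refine (QuotientGroup.eq_one_iff M).2 ?_
  rw [Subgroup.mem_subgroupOf, h]
  exact Subgroup.mem_zpowers _

/-- The product of the two coordinates of `M e₁`, as a function of the class of `M` in `G_q`.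
Its sign says on which side of `0` the cusp `M ∞` lies. -/
noncomputable def cuspSign (q : ℕ) : G q → ℝ :=
  Quotient.lift (fun M : H q => M.1 0 0 * M.1 1 0) (by
    intro M N hMN
    have h := QuotientGroup.leftRel_apply.1 hMN
    rw [Subgroup.mem_subgroupOf] at h
    have hN : N.1 = M.1 * (M⁻¹ * N : H q).1 := by simp
    change M.1 0 0 * M.1 1 0 = N.1 0 0 * N.1 1 0
    rcases eq_or_eq_neg_of_mem_Z h with h | h <;> rw [hN, h] <;> simp)

theorem cuspSign_toG {q : ℕ} (M : H q) : cuspSign q (toG q M) = M.1 0 0 * M.1 1 0 := rfl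

theorem toG_surjective (q : ℕ) : Function.Surjective (toG q) :=
  QuotientGroup.mk'_surjective _

theorem SH_sq (q : ℕ) : toG q (SH q) ^ 2 = 1 := by
  rw [← map_pow]
  apply toG_eq_one_of_eq_neg_one
  apply Subtype.ext
  rw [pow_two, Subgroup.coe_mul, coe_mul, coe_SH]
  ext i j
  fin_cases i <;> fin_cases j <;> simp

theorem cuspSign_SH_mul {q : ℕ} (x : G q) : cuspSign q (toG q (SH q) * x) = -cuspSign q x := by
  obtain ⟨M, rfl⟩ := toG_surjective q x
  rw [← map_mul, cuspSign_toG, cuspSign_toG]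
  rw [Subgroup.coe_mul, coe_mul, coe_SH]
  simp [Matrix.mul_apply, Fin.sum_univ_two, mul_comm]

theorem coe_TH_mul_SH : ((TH 5 * SH 5 : H 5) : Matrix (Fin 2) (Fin 2) ℝ) =
      !![-lam 5, 1; -1, 0] := by
  rw [Subgroup.coe_mul, coe_mul, coe_SH, coe_TH]
  ext i j
  fin_cases i <;> fin_cases j <;> simp

theorem TH_mul_SH_pow_two :
    (((TH 5 * SH 5) ^ 2 : H 5) : Matrix (Fin 2) (Fin 2) ℝ) =
      !![lam 5, -lam 5; lam 5, -1] := by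
  rw [pow_two, Subgroup.coe_mul, coe_mul, coe_TH_mul_SH]
  ext i j
  fin_cases i <;> fin_cases j <;> simp
  linear_combination lam_five_sq

theorem TH_mul_SH_pow_three :
    (((TH 5 * SH 5) ^ 3 : H 5) : Matrix (Fin 2) (Fin 2) ℝ) =
      !![-1, lam 5; -lam 5, lam 5] := by
  rw [pow_succ, Subgroup.coe_mul, coe_mul, TH_mul_SH_pow_two, coe_TH_mul_SH]
  ext i j
  fin_cases i <;> fin_cases j <;> simp <;> linear_combination -lam_five_sq

theorem TH_mul_SH_pow_four :
    (((TH 5 * SH 5) ^ 4 : H 5) : Matrix (Fin 2) (Fin 2) ℝ) = !![0, -1; 1, -lam 5] := by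
  rw [pow_succ, Subgroup.coe_mul, coe_mul, TH_mul_SH_pow_three, coe_TH_mul_SH]
  ext i j
  fin_cases i <;> fin_cases j <;> simp
  linear_combination lam_five_sq

theorem TH_mul_SH_pow_five : toG 5 (TH 5 * SH 5) ^ 5 = 1 := by
  rw [← map_pow]
  convert map_one (toG 5)
  apply Subtype.ext
  apply Subtype.ext
  rw [pow_succ, Subgroup.coe_mul, coe_mul, TH_mul_SH_pow_four, coe_TH_mul_SH]
  ext i j
  fin_cases i <;> fin_cases j <;> simp

/-- The nontrivial powers of `TS` map the negative half-line into the positive one. -/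
theorem cuspSign_TH_mul_SH_pow_mul_pos {k : ℕ} (hk : 0 < k) (hk5 : k < 5) {x : G 5}
    (hx : cuspSign 5 x < 0) : 0 < cuspSign 5 (toG 5 (TH 5 * SH 5) ^ k * x) := by
  obtain ⟨M, rfl⟩ := toG_surjective 5 x
  have hl := one_lt_lam_five
  have hl2 := lam_five_sq
  rw [← map_pow, ← map_mul, cuspSign_toG]
  rw [cuspSign_toG] at hx
  simp only [Subgroup.coe_mul, coe_mul, Matrix.mul_apply, Fin.sum_univ_two]
  have a2 := mul_self_nonneg (M.1 0 0)
  have b2 := mul_self_nonneg (M.1 1 0)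
  generalize M.1 0 0 = a at *
  generalize M.1 1 0 = b at *
  interval_cases k
  · simp only [pow_one, coe_TH_mul_SH]
    simp
    nlinarith
  · simp only [TH_mul_SH_pow_two]
    simp
    nlinarith [mul_nonneg (by linarith : 0 ≤ lam 5) b2,
      mul_nonneg (by positivity : 0 ≤ lam 5 ^ 2) a2]
  · simp only [TH_mul_SH_pow_three]
    simp
    nlinarith [mul_nonneg (by linarith : 0 ≤ lam 5) a2,
      mul_nonneg (by positivity : 0 ≤ lam 5 ^ 2) b2]
  · simp only [TH_mul_SH_pow_four]
    simp
    nlinarith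

/-- The orders `2` and `5` of the two free factors of `G₅`. -/
def factorOrder : Bool → ℕ
  | false => 2
  | true => 5

/-- The generators `S` and `TS` of the two free factors of `G₅`. -/
noncomputable def factorGen : Bool → G 5
  | false => toG 5 (SH 5)
  | true => toG 5 (TH 5 * SH 5)

theorem factorGen_pow : ∀ i, factorGen i ^ factorOrder i = 1
  | false => SH_sq 5
  | true => TH_mul_SH_pow_five

/-- The canonical map `C₂ * C₅ → G₅`. -/
noncomputable def freeProductHom : CoprodI (fun i => Multiplicative (ZMod (factorOrder i))) →* G 5 :=
  CoprodI.lift fun i => cyclicHom (factorOrder i) (factorGen i) (factorGen_pow i)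

theorem freeProductHom_injective : Function.Injective freeProductHom := by
  refine CoprodI.lift_injective_of_ping_pong _ (.inr ⟨true, ?_⟩)
    (fun i => match i with
      | false => {x : G 5 | cuspSign 5 x < 0}
      | true => {x : G 5 | 0 < cuspSign 5 x}) ?_ ?_ ?_
  · change 3 ≤ Cardinal.mk (ZMod 5)
    rw [Cardinal.mk_fintype, ZMod.card]
    norm_num
  -- The two ping-pong sets are nonempty: `(TS)² ∞ = 1` is positive and `S(TS)² ∞ = -1` is negative.
  · have h : 0 < cuspSign 5 (toG 5 ((TH 5 * SH 5) ^ 2)) := by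
      have := one_lt_lam_five
      rw [cuspSign_toG, TH_mul_SH_pow_two]
      simp
      positivity
    rintro (_ | _)
    · refine ⟨toG 5 (SH 5) * toG 5 ((TH 5 * SH 5) ^ 2), ?_⟩
      simpa [cuspSign_SH_mul] using h
    · exact ⟨_, h⟩
  · rintro (_ | _) (_ | _) hij
    · exact absurd rfl hij
    · exact Set.disjoint_left.2 fun x hx hx' => lt_asymm (a := cuspSign 5 x) hx hx'
    · exact Set.disjoint_left.2 fun x hx hx' => lt_asymm (b := cuspSign 5 x) hx hx'
    · exact absurd rfl hij
  · rintro (_ | _) (_ | _) hij x hx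
    · exact absurd rfl hij
    · obtain ⟨k, hk, hk2, hxk⟩ := exists_cyclicHom_eq_pow 2 _ (factorGen_pow false) hx
      obtain rfl : k = 1 := by omega
      rintro _ ⟨y, hy, rfl⟩
      change cuspSign 5 (cyclicHom 2 _ (factorGen_pow false) x * y) < 0
      rw [hxk, pow_one]
      change cuspSign 5 (toG 5 (SH 5) * y) < 0
      rw [cuspSign_SH_mul]
      exact neg_lt_zero.2 hy
    · obtain ⟨k, hk, hk5, hxk⟩ := exists_cyclicHom_eq_pow 5 _ (factorGen_pow true) hx
      rintro _ ⟨y, hy, rfl⟩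
      change 0 < cuspSign 5 (cyclicHom 5 _ (factorGen_pow true) x * y)
      rw [hxk]
      exact cuspSign_TH_mul_SH_pow_mul_pos hk hk5 hy
    · exact absurd rfl hij

theorem cyclicHom_ofAdd_one {Γ : Type*} [Group Γ] (n : ℕ) (g : Γ) (hg : g ^ n = 1) :
    cyclicHom n g hg (Multiplicative.ofAdd 1) = g := by
  simpa using cyclicHom_ofAdd n g hg 1

theorem freeProductHom_of (i : Bool) :
    freeProductHom (CoprodI.of (i := i) (Multiplicative.ofAdd 1)) = factorGen i := by
  rw [freeProductHom, CoprodI.lift_of, cyclicHom_ofAdd_one]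

theorem freeProductHom_surjective : Function.Surjective freeProductHom := by
  have hS : toG 5 (SH 5) ∈ freeProductHom.range := ⟨_, freeProductHom_of false⟩
  have hU : toG 5 (TH 5) * toG 5 (SH 5) ∈ freeProductHom.range :=
    ⟨_, (freeProductHom_of true).trans (map_mul _ _ _)⟩
  have hT : toG 5 (TH 5) ∈ freeProductHom.range := (Subgroup.mul_mem_cancel_right _ hS).1 hU
  have htop : freeProductHom.range.comap (toG 5) = ⊤ := by
    refine eq_top_iff.2 ((Subgroup.closure_closure_coe_preimage (k := {S, T 5})).ge.trans ?_)
    refine (Subgroup.closure_le _).2 ?_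
    rintro ⟨M, hM⟩ (rfl | rfl : M = S ∨ M = T 5)
    · exact hS
    · exact hT
  intro x
  obtain ⟨M, rfl⟩ := toG_surjective 5 x
  exact (htop ▸ Subgroup.mem_top M : M ∈ freeProductHom.range.comap (toG 5))

/-- The character of `G₅ = C₂ * C₅` that kills `S`: since `T = (TS)S⁻¹`, it sends `T` to the
generator of `ℤ/5`. -/
theorem exists_character : ∃ φ : G 5 →* Multiplicative (ZMod 5),
    φ (toG 5 (SH 5)) = 1 ∧ φ (toG 5 (TH 5)) = Multiplicative.ofAdd 1 := by
  let g : Bool → Multiplicative (ZMod 5) := fun i => bif i then Multiplicative.ofAdd 1 else 1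
  have hg : ∀ i, g i ^ factorOrder i = 1 := by
    rintro (_ | _)
    · exact one_pow _
    · change Multiplicative.ofAdd (1 : ZMod 5) ^ 5 = 1
      decide
  let e := MulEquiv.ofBijective freeProductHom
    ⟨freeProductHom_injective, freeProductHom_surjective⟩
  let ψ := CoprodI.lift fun i => cyclicHom (factorOrder i) (g i) (hg i)
  have key : ∀ i, ψ (e.symm (factorGen i)) = g i := by
    intro i
    have : e.symm (factorGen i) = CoprodI.of (i := i) (Multiplicative.ofAdd 1) := by
      rw [MulEquiv.symm_apply_eq]
      exact (freeProductHom_of i).symm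
    rw [this, CoprodI.lift_of, cyclicHom_ofAdd_one]
  have hS : ψ (e.symm (toG 5 (SH 5))) = 1 := key false
  refine ⟨ψ.comp e.symm.toMonoidHom, hS, ?_⟩
  have hU : ψ (e.symm (toG 5 (TH 5 * SH 5))) = Multiplicative.ofAdd 1 := key true
  rw [map_mul, map_mul, map_mul, hS, mul_one] at hU
  exact hU

/-! ### Two identities in `SL₂` over a quotient of `ℤ[λ₅]` -/

section Identities

variable {B : Type*} [CommRing B]

variable (B) in
/-- The matrix `S` over an arbitrary commutative ring. -/
def sMat : SpecialLinearGroup (Fin 2) B :=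
  ⟨!![0, 1; -1, 0], by simp [det_fin_two_of]⟩

/-- The matrix `T` over an arbitrary commutative ring, with translation length `l`. -/
def tMat (l : B) : SpecialLinearGroup (Fin 2) B :=
  ⟨!![1, l; 0, 1], by simp [det_fin_two_of]⟩

/-- The word `T⁻¹ S T S⁻¹ T⁻¹`. When `l² = l + 1` it is `-l (0, 1; 1, 0)` modulo `2l - 1`, so that
it anticommutes with `S` there. -/
def rMat (l : B) : SpecialLinearGroup (Fin 2) B :=
  (tMat l)⁻¹ * sMat B * tMat l * (sMat B)⁻¹ * (tMat l)⁻¹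

theorem coe_sMat : (sMat B : Matrix (Fin 2) (Fin 2) B) = !![0, 1; -1, 0] := rfl

theorem coe_tMat (l : B) : (tMat l : Matrix (Fin 2) (Fin 2) B) = !![1, l; 0, 1] := rfl

theorem tMat_pow (l : B) (n : ℕ) : tMat l ^ n = tMat (n * l) := by
  induction n with
  | zero =>
    apply Subtype.ext
    rw [coe_tMat]
    simp [one_fin_two]
  | succ n ih =>
    rw [pow_succ, ih]
    apply Subtype.ext
    rw [coe_mul, coe_tMat, coe_tMat, coe_tMat]
    ext i j
    fin_cases i <;> fin_cases j <;> simp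
    ring

theorem coe_rMat {l : B} (hl : l ^ 2 = l + 1) :
    (rMat l : Matrix (Fin 2) (Fin 2) B) =
      !![l * (2 * l - 1), -l - l ^ 2 * (2 * l - 1); -l, l * (2 * l - 1)] := by
  simp only [rMat, coe_mul, coe_inv, coe_sMat, coe_tMat, adjugate_fin_two_of]
  ext i j
  fin_cases i <;> fin_cases j <;> simp
  · linear_combination -hl
  · linear_combination l * hl
  · linear_combination -hl

/-- Modulo `2l - 1` the matrix `R S⁻¹` is diagonal with entries `-l, l`, and `l² = -1` there, so it
conjugates a translation by a length `x` killed by `2l - 1` into the inverse translation. -/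
theorem conj_tMat_mul_tMat {l x : B} (hl : l ^ 2 = l + 1) (hx : x * (2 * l - 1) = 0) :
    rMat l * (sMat B)⁻¹ * tMat x * (rMat l * (sMat B)⁻¹)⁻¹ * tMat x = 1 := by
  have h : rMat l * (sMat B)⁻¹ * tMat x = (tMat x)⁻¹ * (rMat l * (sMat B)⁻¹) := by
    apply Subtype.ext
    simp only [coe_mul, coe_inv, coe_sMat, coe_tMat, coe_rMat hl, adjugate_fin_two_of]
    ext i j
    fin_cases i <;> fin_cases j <;> simp
    · linear_combination l * hx
    · linear_combination -l ^ 2 * hx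
    · linear_combination l * hx
  rw [h]
  group

/-- Suppose `e² = 0` and `e` is killed by `2l - 1`, and let `h = 1 + eX`. Then `e tr X = 0`, so
`X + S X S⁻¹` is, after multiplication by `e`, a multiple of `S`; conjugation by `R` changes its
sign, and the product of the four conjugates of `h` is trivial. -/
theorem prod_conj_eq_one {l e : B} (hl : l ^ 2 = l + 1) (he : e * e = 0)
    (hel : e * (2 * l - 1) = 0) {h : SpecialLinearGroup (Fin 2) B} {X : Matrix (Fin 2) (Fin 2) B}
    (hh : (h : Matrix (Fin 2) (Fin 2) B) = 1 + e • X) :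
    h * (sMat B * h * (sMat B)⁻¹) *
      (rMat l * (h * (sMat B * h * (sMat B)⁻¹)) * (rMat l)⁻¹) = 1 := by
  have hh' : (h : Matrix (Fin 2) (Fin 2) B) =
      !![1 + e * X 0 0, e * X 0 1; e * X 1 0, 1 + e * X 1 1] := by
    rw [hh]
    ext i j
    fin_cases i <;> fin_cases j <;> simp
  have htr : e * (X 0 0 + X 1 1) = 0 := by
    have := h.det_coe
    rw [hh', det_fin_two_of] at this
    linear_combination this - (X 0 0 * X 1 1 - X 0 1 * X 1 0) * he
  have hk : ((h * (sMat B * h * (sMat B)⁻¹) : SpecialLinearGroup (Fin 2) B) :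
      Matrix (Fin 2) (Fin 2) B) =
      !![1, e * (X 0 1 - X 1 0); -(e * (X 0 1 - X 1 0)), 1] := by
    simp only [coe_mul, coe_inv, coe_sMat, hh', adjugate_fin_two_of]
    ext i j
    fin_cases i <;> fin_cases j <;> simp
    · linear_combination htr + (X 0 0 * X 1 1 - X 0 1 * X 0 1) * he
    · linear_combination (-X 0 0 * X 1 0 + X 0 1 * X 0 0) * he
    · linear_combination (X 1 0 * X 1 1 - X 1 1 * X 0 1) * he
    · linear_combination htr + (X 0 0 * X 1 1 - X 1 0 * X 1 0) * he
  generalize h * (sMat B * h * (sMat B)⁻¹) = k at hk ⊢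
  have hR : k * rMat l * k = rMat l := by
    apply Subtype.ext
    simp only [coe_mul, hk, coe_rMat hl]
    set y := X 0 1 - X 1 0
    ext i j
    fin_cases i <;> fin_cases j <;> simp
    · linear_combination l ^ 2 * y * hel - l * (2 * l - 1) * y ^ 2 * he
    · linear_combination 2 * l * y * hel - l * y ^ 2 * he
    · linear_combination -2 * l * y * hel - (l + l ^ 2 * (2 * l - 1)) * y ^ 2 * he
    · linear_combination l ^ 2 * y * hel - l * (2 * l - 1) * y ^ 2 * he
  rw [← mul_assoc, ← mul_assoc, hR, mul_inv_cancel]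

theorem map_sMat {C : Type*} [CommRing C] (f : B →+* C) :
    SpecialLinearGroup.map f (sMat B) = sMat C := by
  apply Subtype.ext
  ext i j
  change f ((!![0, 1; -1, 0] : Matrix (Fin 2) (Fin 2) B) i j) =
    (!![0, 1; -1, 0] : Matrix (Fin 2) (Fin 2) C) i j
  fin_cases i <;> fin_cases j <;> simp

theorem map_tMat {C : Type*} [CommRing C] (f : B →+* C) (l : B) :
    SpecialLinearGroup.map f (tMat l) = tMat (f l) := by
  apply Subtype.ext
  ext i j
  change f ((!![1, l; 0, 1] : Matrix (Fin 2) (Fin 2) B) i j) =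
    (!![1, f l; 0, 1] : Matrix (Fin 2) (Fin 2) C) i j
  fin_cases i <;> fin_cases j <;> simp

theorem map_rMat {C : Type*} [CommRing C] (f : B →+* C) (l : B) :
    SpecialLinearGroup.map f (rMat l) = rMat (f l) := by
  simp only [rMat, map_mul, map_inv, map_sMat, map_tMat]

/-- Reduction of `SL₂(B)` modulo the principal ideal generated by `e`. -/
def red (e : B) :
    SpecialLinearGroup (Fin 2) B →* SpecialLinearGroup (Fin 2) (B ⧸ Ideal.span {e}) :=
  SpecialLinearGroup.map (Ideal.Quotient.mk (Ideal.span {e}))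

theorem dvd_sub_one_of_red_eq_one {e : B} {h : SpecialLinearGroup (Fin 2) B} (hh : red e h = 1)
    (i j : Fin 2) : e ∣ h.1 i j - (1 : Matrix (Fin 2) (Fin 2) B) i j := by
  rw [← Ideal.mem_span_singleton, ← Ideal.Quotient.eq_zero_iff_mem, map_sub, sub_eq_zero]
  have := congr_arg (fun g : SpecialLinearGroup (Fin 2) (B ⧸ Ideal.span {e}) => g.1 i j) hh
  refine this.trans ?_
  fin_cases i <;> fin_cases j <;> simp

end Identities

/-! ### Deep congruence elements with nontrivial character -/

/-- The number `λ₅` as an element of `ℤ[λ₅]`. -/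
noncomputable def lamO : ZLam 5 := ⟨lam 5, Algebra.subset_adjoin rfl⟩

theorem lamO_sq : lamO ^ 2 = lamO + 1 := Subtype.ext lam_five_sq

/-- The matrices over `ℤ[λ₅]` that belong to `H₅`. -/
noncomputable def HO : Subgroup (SpecialLinearGroup (Fin 2) (ZLam 5)) :=
  (H 5).comap (SpecialLinearGroup.map (algebraMap (ZLam 5) ℝ))

/-- The inclusion of `HO` in `H₅`. -/
noncomputable def HO.toH : HO →* H 5 :=
  (SpecialLinearGroup.map (algebraMap (ZLam 5) ℝ)).subgroupComap (H 5)

theorem map_sMat_real : SpecialLinearGroup.map (algebraMap (ZLam 5) ℝ) (sMat (ZLam 5)) = S :=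
  map_sMat _

theorem map_tMat_real : SpecialLinearGroup.map (algebraMap (ZLam 5) ℝ) (tMat lamO) = T 5 :=
  map_tMat _ _

/-- The matrix `S` as an element of `HO`. -/
noncomputable def SO : HO := ⟨sMat _, by
  rw [HO, Subgroup.mem_comap, map_sMat_real]; exact S_mem_H 5⟩

/-- The matrix `T` as an element of `HO`. -/
noncomputable def TO : HO := ⟨tMat lamO, by
  rw [HO, Subgroup.mem_comap, map_tMat_real]; exact T_mem_H 5⟩

/-- The matrix `R = T⁻¹ S T S⁻¹ T⁻¹` as an element of `HO`. -/
noncomputable def RO : HO := TO⁻¹ * SO * TO * SO⁻¹ * TO⁻¹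

theorem toH_SO : HO.toH SO = SH 5 := Subtype.ext (map_sMat_real :)

theorem toH_TO : HO.toH TO = TH 5 := Subtype.ext (map_tMat_real :)

/-- Let `φ` be a character of order `5` that kills `S` but not `T`, and let `m` be prime to `5`.
Since `2λ - 1 = √5` is, up to associates, the only prime above `5`, this says that `φ` is
nontrivial on `HO ∩ Γ(m√5ᵏ)` for all `k ≥ 1`. -/
theorem exists_red_eq_one_character_ne_one (φ : HO →* Multiplicative (ZMod 5)) (hS : φ SO = 1)
    (hT : φ TO = Multiplicative.ofAdd 1) {m : ℕ} (hm : ¬ 5 ∣ m) (k : ℕ) :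
    ∃ h : HO, red ((m : ZLam 5) * (2 * lamO - 1) ^ (k + 1)) h = 1 ∧ φ h ≠ 1 := by
  induction k with
  | zero =>
    -- `T ^ m` lies in `Γ(m)`; conjugation by `R S⁻¹` inverts it modulo `m√5` but not under `φ`.
    refine ⟨RO * SO⁻¹ * TO ^ m * (RO * SO⁻¹)⁻¹ * TO ^ m, ?_, ?_⟩
    · rw [zero_add, pow_one]
      set e := (m : ZLam 5) * (2 * lamO - 1) with he
      set q := Ideal.Quotient.mk (Ideal.span {e})
      have hx : q (m * lamO) * (2 * q lamO - 1) = 0 := by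
        have : q ((m * lamO) * (2 * lamO - 1)) = 0 := Ideal.Quotient.eq_zero_iff_mem.2
          (Ideal.mem_span_singleton.2 ⟨lamO, by rw [he]; ring⟩)
        rwa [map_mul, map_sub, map_mul q 2, map_ofNat, map_one] at this
      have hl : q lamO ^ 2 = q lamO + 1 := by rw [← map_pow, lamO_sq]; simp
      rw [← conj_tMat_mul_tMat hl hx, ← map_rMat, ← map_sMat q, ← map_tMat, ← tMat_pow]
      simp only [← map_mul, ← map_inv]
      rfl
    · have h : φ (RO * SO⁻¹ * TO ^ m * (RO * SO⁻¹)⁻¹ * TO ^ m) = φ TO ^ (2 * m) := by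
        rw [map_mul, map_mul, map_mul φ _ (TO ^ m), map_inv, mul_right_comm (φ (RO * SO⁻¹)),
          mul_inv_cancel, one_mul, map_pow, two_mul, pow_add]
      rw [h, hT, ← ofAdd_nsmul, Ne, ofAdd_eq_one, nsmul_one, ZMod.natCast_eq_zero_iff]
      omega
  | succ k ih =>
    obtain ⟨h, hh, hφ⟩ := ih
    -- `φ` takes the value `φ h ^ 4` on the product of the conjugates of `h` by `1, S, R, RS`.
    refine ⟨h * (SO * h * SO⁻¹) * (RO * (h * (SO * h * SO⁻¹)) * RO⁻¹), ?_, ?_⟩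
    · choose X hX using dvd_sub_one_of_red_eq_one hh
      rw [pow_succ, ← mul_assoc]
      set e := (m : ZLam 5) * (2 * lamO - 1) ^ (k + 1) with he
      set q := Ideal.Quotient.mk (Ideal.span {e * (2 * lamO - 1)})
      -- This is where the exponent `k + 1 ≥ 1` matters: `e²` is divisible by `e√5`.
      have hee : q e * q e = 0 := by
        rw [← map_mul]
        refine Ideal.Quotient.eq_zero_iff_mem.2 (Ideal.mem_span_singleton.2
          ⟨m * (2 * lamO - 1) ^ k, ?_⟩)
        rw [he]
        ring
      have hel : q e * (2 * q lamO - 1) = 0 := by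
        have : q (e * (2 * lamO - 1)) = 0 :=
          Ideal.Quotient.eq_zero_iff_mem.2 (Ideal.mem_span_singleton_self _)
        rwa [map_mul, map_sub, map_mul q 2, map_ofNat, map_one] at this
      have hl : q lamO ^ 2 = q lamO + 1 := by rw [← map_pow, lamO_sq]; simp
      have hq : (SpecialLinearGroup.map q h.1 : Matrix (Fin 2) (Fin 2) _) =
          1 + q e • Matrix.of (fun i j => q (X i j)) := by
        ext i j
        have : h.1.1 i j = (1 : Matrix (Fin 2) (Fin 2) (ZLam 5)) i j + e * X i j := by
          rw [← hX]; ring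
        change q (h.1.1 i j) = _
        rw [this]
        fin_cases i <;> fin_cases j <;> simp
      rw [← prod_conj_eq_one hl hee hel hq, ← map_rMat, ← map_sMat q]
      simp only [← map_mul, ← map_inv]
      rfl
    · have hk : φ (h * (SO * h * SO⁻¹) * (RO * (h * (SO * h * SO⁻¹)) * RO⁻¹)) = φ h ^ 4 := by
        simp only [map_mul, map_inv, hS, one_mul, inv_one, mul_one]
        rw [mul_right_comm (φ RO), mul_inv_cancel, one_mul]
        simp only [pow_succ, pow_zero, one_mul, mul_assoc]
      rw [hk]
      generalize φ h = x at hφ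
      revert x
      decide

/-! ### Kernels of characters are not congruence subgroups -/

instance : Algebra.IsIntegral ℤ (ZLam 5) := by
  refine ⟨fun x => ?_⟩
  have hlam : IsIntegral ℤ (lam 5) := by
    refine ⟨Polynomial.X ^ 2 - Polynomial.X - 1, by monicity!, ?_⟩
    simp [lam_five_sq]
  have h : ZLam 5 ≤ integralClosure ℤ ℝ := by
    refine Algebra.adjoin_le ?_
    rintro _ rfl
    exact hlam
  exact (isIntegral_algHom_iff (ZLam 5).val Subtype.val_injective).1 (h x.2)

theorem exists_natCast_mem_of_ne_bot {A : Ideal (ZLam 5)} (hA : A ≠ ⊥) :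
    ∃ n : ℕ, n ≠ 0 ∧ (n : ZLam 5) ∈ A := by
  obtain ⟨x, hx, hx0⟩ := Submodule.exists_mem_ne_zero_of_ne_bot hA
  have h := Ideal.comap_ne_bot_of_integral_mem (R := ℤ) hx0 hx (Algebra.IsIntegral.isIntegral x)
  obtain ⟨n, hn, hn0⟩ := Submodule.exists_mem_ne_zero_of_ne_bot h
  refine ⟨n.natAbs, by simpa using hn0, ?_⟩
  have hn' : (n : ZLam 5) ∈ A := by simpa using hn
  rcases n.natAbs_eq with h | h <;> rw [h] at hn' <;> simpa using hn'

/-- The kernel of a character of order `5` of `G₅` that kills `S` but not `T` contains no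
principal congruence subgroup. -/
theorem not_isCongruence_of_le_ker {φ : G 5 →* Multiplicative (ZMod 5)}
    (hS : φ (toG 5 (SH 5)) = 1) (hT : φ (toG 5 (TH 5)) = Multiplicative.ofAdd 1)
    {K : Subgroup (G 5)} (hK : K ≤ φ.ker) : ¬ IsCongruence K := by
  rintro ⟨A, hA, hAK⟩
  obtain ⟨n, hn, hnA⟩ := exists_natCast_mem_of_ne_bot hA
  obtain ⟨k, m, hm, rfl⟩ := Nat.exists_eq_pow_mul_and_not_dvd hn 5 (by norm_num)
  obtain ⟨h, hh, hφ⟩ := exists_red_eq_one_character_ne_one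
    (φ.comp ((toG 5).comp HO.toH)) (by simpa [toH_SO] using hS) (by simpa [toH_TO] using hT)
    hm (2 * k)
  have heA : (m : ZLam 5) * (2 * lamO - 1) ^ (2 * k + 1) ∈ A := by
    have h5 : (2 * lamO - 1) ^ 2 = 5 := by linear_combination 4 * lamO_sq
    rw [pow_succ, pow_mul, h5]
    have := A.mul_mem_left (2 * lamO - 1) hnA
    push_cast at this
    convert this using 1
    ring
  have hmem : ∀ i j, (HO.toH h).1.1 i j - (1 : Matrix (Fin 2) (Fin 2) ℝ) i j ∈ idealSet A := by
    intro i j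
    refine ⟨_, A.mem_of_dvd (dvd_sub_one_of_red_eq_one hh i j) heA, ?_⟩
    have h1 : (((1 : Matrix (Fin 2) (Fin 2) (ZLam 5)) i j : ZLam 5) : ℝ) =
        (1 : Matrix (Fin 2) (Fin 2) ℝ) i j := by
      fin_cases i <;> fin_cases j <;> simp
    rw [AddSubgroupClass.coe_sub, h1]
    rfl
  refine hφ (hK (hAK ⟨HO.toH h, ⟨?_, ?_, ?_, ?_⟩, rfl⟩))
  · simpa using hmem 0 0
  · simpa using hmem 1 1
  · simpa using hmem 0 1
  · simpa using hmem 1 0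

end Hecke

theorem proposition5p2 :
    ¬ Hecke.IsCongruence (Hecke.powerSubgroup (Hecke.G 5) 5) ∧
      ¬ Hecke.IsCongruence (commutator (Hecke.G 5)) := by
  obtain ⟨φ, hS, hT⟩ := Hecke.exists_character
  refine ⟨Hecke.not_isCongruence_of_le_ker hS hT ?_, Hecke.not_isCongruence_of_le_ker hS hT ?_⟩
  · refine (Subgroup.closure_le _).2 ?_
    rintro _ ⟨x, rfl⟩
    change φ (x ^ 5) = 1
    rw [map_pow]
    generalize φ x = y
    revert y
    decide
  · exact Abelianization.commutator_subset_ker φ
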